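/- **Quantum query lower bound for Strong Connectivity in the adjacency array model.** A directed graph on the vertex set $\{0,\dots,n-1\}$ with out-degrees $d_0,\dots,d_{n-1}$ and $m=\sum_i d_i$ edges is given by arrays $f_i:\{0,\dots,d_i-1\}\to\{0,\dots,n-1\}$, where $f_i(j)$ is the $j$-th out-neighbour of vertex $i$. The graph is promised to be simple: $f_i(j)\ne f_i(j')$ for $j\neq j'$, and $f_i(j)\neq i$. The out-degrees are known to the algorithm at no cost; one query is one application of the unitary $|i,j\rangle|a\rangle\mapsto|i,j\rangle|a+f_i(j) \bmod n\rangle$ (or of the identity on a designated no-query state of the index register). A quantum algorithm with $T$ queries alternates $T$ queries with arbitrary unitaries that do not depend on the arrays (but may depend on $n$ and the out-degrees), on a state space with a workspace of arbitrary finite dimension, starting from a fixed basis state and ending with a measurement in the computational basis. *Strong Connectivity* asks whether there is a directed path from every vertex to every vertex. **Theorem.** Strong Connectivity requires $\Omega(\sqrt{nm})$ quantum queries in the array model. Precisely, for all reals $\varepsilon>0$ and $\delta<\tfrac12$ there are $c>0$ and $N\in\mathbb N$ such that for all $n\ge N$, $n\ge 1$, and all $m$ with $n\le m\le(1-\varepsilon)n^2$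 the following holds. If $T$ is such that for every sequence of out-degrees with sum $m$ there is a quantum algorithm with $T$ queries that decides, with error probability at most $\delta$ on every input that satisfies the promise, whether the given graph is strongly connected, then $T\ge c\sqrt{nm}$. -/

import Mathlib

/-! ### Quantum query algorithms -/

/-- Computational basis of a query algorithm for inputs `x : I → A` with workspace of dimension `w`:
a query register (`none` stands for "no query"), an answer register, and the workspace. -/
abbrev QBasis (I A : Type) (w : ℕ) : Type := Option I × A × Fin w

/-- The standard oracle of the input `x`, as a linear operator on state vectors:
`|i, a, z⟩ ↦ |i, a + x i, z⟩`, and the identity where the query register holds `none`. -/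
def queryOp {I A : Type} [AddGroup A] {w : ℕ} (x : I → A) (ψ : QBasis I A w → ℂ) :
    QBasis I A w → ℂ
  | (none, a, z) => ψ (none, a, z)
  | (some i, a, z) => ψ (some i, a - x i, z)

/-- A quantum query algorithm for inputs `x : I → A`: a workspace, an initial basis state,
a sequence of unitaries that do not depend on the input, and the set of those outcomes of the final
measurement in the computational basis on which the algorithm accepts. -/
structure QueryAlgorithm (I A : Type) [Fintype I] [DecidableEq I] [Fintype A] [DecidableEq A] where
  /-- Dimension of the workspace. -/
  w : ℕ
  /-- Initial basis state. -/
  start : QBasis I A w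
  /-- `U t` is the unitary applied after the first `t` queries. -/
  U : ℕ → Matrix.unitaryGroup (QBasis I A w) ℂ
  /-- Accepting measurement outcomes. -/
  accept : Finset (QBasis I A w)

namespace QueryAlgorithm

variable {I A : Type} [Fintype I] [DecidableEq I] [Fintype A] [DecidableEq A] [AddGroup A]

/-- The state `U_t O_x U_{t-1} O_x ⋯ O_x U_0 |start⟩` reached with `t` queries to `x`. -/
noncomputable def state (alg : QueryAlgorithm I A) (x : I → A) : ℕ → QBasis I A alg.w → ℂ
  | 0 => Matrix.mulVec (alg.U 0).1 (Pi.single alg.start 1)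
  | t + 1 => Matrix.mulVec (alg.U (t + 1)).1 (queryOp x (state alg x t))

/-- Probability that the algorithm accepts `x` when it is stopped after `T` queries. -/
noncomputable def acceptProb (alg : QueryAlgorithm I A) (T : ℕ) (x : I → A) : ℝ :=
  ∑ b ∈ alg.accept, ‖alg.state x T b‖ ^ 2

/-- With `T` queries, the algorithm decides the property `P` with error probability at most `δ`
on every input that satisfies `promise`. -/
def Decides (alg : QueryAlgorithm I A) (T : ℕ) (δ : ℝ) (promise P : (I → A) → Prop) : Prop :=
  ∀ x : I → A, promise x →
    (P x → 1 - δ ≤ alg.acceptProb T x) ∧ (¬ P x → alg.acceptProb T x ≤ δ)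

end QueryAlgorithm

/-! ### Directed graphs in the adjacency array model -/

/-- Positions of the adjacency arrays for out-degrees `d`: pairs of a vertex `i` and `j < d i`. -/
abbrev ArrayPos {n : ℕ} (d : Fin n → ℕ) : Type := Σ i : Fin n, Fin (d i)

/-- The directed graph given by the arrays `f`: its edges are the pairs `(i, f i j)`. -/
def arrayDigraph {n : ℕ} {d : Fin n → ℕ} (f : ArrayPos d → Fin n) : Digraph (Fin n) where
  Adj u v := ∃ j : Fin (d u), f ⟨u, j⟩ = v

/-- The simple graph promise: no multiple edges and no loops. -/
def ArraySimple {n : ℕ} {d : Fin n → ℕ} (f : ArrayPos d → Fin n) : Prop :=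
  (∀ i : Fin n, Function.Injective fun j : Fin (d i) => f ⟨i, j⟩) ∧ ∀ p : ArrayPos d, f p ≠ p.1

/-- There is a directed path from every vertex to every vertex. -/
def Digraph.StronglyConn {V : Type} (G : Digraph V) : Prop :=
  ∀ u v : V, Relation.ReflTransGen G.Adj u v

/-- Strong connectivity of simple directed graphs with `n` vertices and `m` edges, given by their
adjacency arrays, is decided by quantum algorithms with `T` queries and error at most `δ`.
The out-degrees `d` are known at no cost, so the algorithm may depend on `d` in any way; only
accesses to the arrays are counted. -/
def StrongConnectivitySolvable (n m T : ℕ) [NeZero n] (δ : ℝ) : Prop :=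
  ∀ d : Fin n → ℕ, ∑ i, d i = m →
    ∃ alg : QueryAlgorithm (ArrayPos d) (Fin n),
      alg.Decides T δ ArraySimple fun f => (arrayDigraph f).StronglyConn

/-! ### The adversary method -/

/-- The squared Euclidean norm of a state vector. -/
noncomputable def sqNorm {B : Type} [Fintype B] (ψ : B → ℂ) : ℝ := ∑ b, ‖ψ b‖ ^ 2

theorem ofReal_sqNorm {B : Type} [Fintype B] (ψ : B → ℂ) :
    ((sqNorm ψ : ℝ) : ℂ) = star ψ ⬝ᵥ ψ := by
  simp only [sqNorm, dotProduct, Pi.star_apply, Complex.ofReal_sum]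
  refine Finset.sum_congr rfl fun b _ => ?_
  rw [RCLike.star_def, Complex.conj_mul']
  push_cast
  rfl

theorem sqNorm_mulVec {B : Type} [Fintype B] [DecidableEq B] (U : Matrix.unitaryGroup B ℂ)
    (ψ : B → ℂ) : sqNorm (Matrix.mulVec U.1 ψ) = sqNorm ψ := by
  have h : (star U.1) * U.1 = 1 := Matrix.UnitaryGroup.star_mul_self U
  apply Complex.ofReal_injective
  rw [ofReal_sqNorm, ofReal_sqNorm, Matrix.star_mulVec, ← Matrix.dotProduct_mulVec,
    Matrix.mulVec_mulVec, ← Matrix.star_eq_conjTranspose, h, Matrix.one_mulVec]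

/-- The weight with which the query register of `ψ` holds `i`. -/
noncomputable def queryMass {I A : Type} [Fintype A] {w : ℕ} (ψ : QBasis I A w → ℂ) (i : I) : ℝ :=
  ∑ p : A × Fin w, ‖ψ (some i, p)‖ ^ 2

theorem queryMass_nonneg {I A : Type} [Fintype A] {w : ℕ} (ψ : QBasis I A w → ℂ) (i : I) :
    0 ≤ queryMass ψ i :=
  Finset.sum_nonneg fun _ _ => sq_nonneg _

theorem sqNorm_eq_sum_queryMass {I A : Type} [Fintype I] [Fintype A] {w : ℕ}
    (ψ : QBasis I A w → ℂ) :
    sqNorm ψ = (∑ p : A × Fin w, ‖ψ (none, p)‖ ^ 2) + ∑ i, queryMass ψ i := by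
  unfold sqNorm queryMass
  rw [Fintype.sum_prod_type, Fintype.sum_option]

theorem queryMass_queryOp {I A : Type} [Fintype A] [AddGroup A] {w : ℕ} (x : I → A)
    (ψ : QBasis I A w → ℂ) (i : I) : queryMass (queryOp x ψ) i = queryMass ψ i := by
  unfold queryMass
  rw [Fintype.sum_prod_type, Fintype.sum_prod_type]
  exact Fintype.sum_equiv (Equiv.subRight (x i)) _ _ fun a => rfl

theorem sqNorm_queryOp {I A : Type} [Fintype I] [Fintype A] [AddGroup A] {w : ℕ} (x : I → A)
    (ψ : QBasis I A w → ℂ) : sqNorm (queryOp x ψ) = sqNorm ψ := by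
  rw [sqNorm_eq_sum_queryMass, sqNorm_eq_sum_queryMass]
  simp only [queryMass_queryOp]
  rfl

theorem two_mul_le_of_one_le_mul {a b u v : ℝ} (hu : 0 ≤ u) (hv : 0 ≤ v)
    (huv : 1 ≤ u * v) : 2 * a * b ≤ u * a ^ 2 + v * b ^ 2 := by
  refine abs_le_of_sq_le_sq' ?_ (by positivity) |>.2
  have h1 : 0 ≤ (u * a ^ 2 - v * b ^ 2) ^ 2 := sq_nonneg _
  have h2 : 1 * (a * b) ^ 2 ≤ u * v * (a * b) ^ 2 :=
    mul_le_mul_of_nonneg_right huv (sq_nonneg _)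
  nlinarith

theorem queryMass_sub_le {I A : Type} [Fintype A] {w : ℕ} (φ φ' : QBasis I A w → ℂ) (i : I)
    {u v : ℝ} (hu : 0 ≤ u) (hv : 0 ≤ v) (huv : 1 ≤ u * v) :
    queryMass (φ - φ') i ≤ (1 + u) * queryMass φ i + (1 + v) * queryMass φ' i := by
  unfold queryMass
  rw [Finset.mul_sum, Finset.mul_sum, ← Finset.sum_add_distrib]
  refine Finset.sum_le_sum fun p _ => ?_
  have h := norm_sub_le (φ (some i, p)) (φ' (some i, p))
  have h2 := two_mul_le_of_one_le_mul (a := ‖φ (some i, p)‖) (b := ‖φ' (some i, p)‖) hu hv huv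
  have h3 := pow_le_pow_left₀ (norm_nonneg _) h 2
  simp only [Pi.sub_apply]
  nlinarith

theorem le_queryMass_sub {I A : Type} [Fintype A] {w : ℕ} (φ φ' : QBasis I A w → ℂ) (i : I)
    {u v : ℝ} (hu : 0 ≤ u) (hv : 0 ≤ v) (huv : 1 ≤ u * v) :
    (1 - u) * queryMass φ i + (1 - v) * queryMass φ' i ≤ queryMass (φ - φ') i := by
  unfold queryMass
  rw [Finset.mul_sum, Finset.mul_sum, ← Finset.sum_add_distrib]
  refine Finset.sum_le_sum fun p _ => ?_
  have h := abs_norm_sub_norm_le (φ (some i, p)) (φ' (some i, p))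
  have h2 := two_mul_le_of_one_le_mul (a := ‖φ (some i, p)‖) (b := ‖φ' (some i, p)‖) hu hv huv
  have h3 := pow_le_pow_left₀ (abs_nonneg _) h 2
  rw [sq_abs] at h3
  simp only [Pi.sub_apply]
  nlinarith

/-- A query moves two states apart only through the positions where the inputs differ. -/
theorem sqNorm_queryOp_sub_le {I A : Type} [Fintype I] [Fintype A] [DecidableEq A]
    [AddGroup A] {w : ℕ} (x y : I → A) (φ φ' : QBasis I A w → ℂ) (u v : I → ℝ) (hu : ∀ i, 0 ≤ u i) (hv : ∀ i, 0 ≤ v i)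
    (huv : ∀ i, x i ≠ y i → 1 ≤ u i * v i) :
    sqNorm (queryOp x φ - queryOp y φ') ≤ sqNorm (φ - φ') +
      ((∑ i, if x i ≠ y i then 2 * (u i * queryMass φ i) else 0) +
        ∑ i, if y i ≠ x i then 2 * (v i * queryMass φ' i) else 0) := by
  rw [sqNorm_eq_sum_queryMass, sqNorm_eq_sum_queryMass, add_assoc]
  refine add_le_add le_rfl ?_
  rw [← Finset.sum_add_distrib, ← Finset.sum_add_distrib]
  refine Finset.sum_le_sum fun i _ => ?_
  by_cases h : x i = y i
  · have h' : queryMass (queryOp x φ - queryOp y φ') i = queryMass (φ - φ') i := by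
      rw [← queryMass_queryOp x (φ - φ')]
      unfold queryMass
      refine Finset.sum_congr rfl fun p _ => ?_
      simp [queryOp, h]
    simp [h, h']
  · have h1 := queryMass_sub_le (queryOp x φ) (queryOp y φ') i (hu i) (hv i) (huv i h)
    have h2 := le_queryMass_sub φ φ' i (hu i) (hv i) (huv i h)
    rw [queryMass_queryOp, queryMass_queryOp] at h1
    rw [if_pos h, if_pos (Ne.symm h)]
    linarith

namespace QueryAlgorithm

variable {I A : Type} [Fintype I] [DecidableEq I] [Fintype A] [DecidableEq A] [AddGroup A]

theorem sqNorm_state (alg : QueryAlgorithm I A) (x : I → A) (t : ℕ) :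
    sqNorm (alg.state x t) = 1 := by
  induction t with
  | zero =>
    rw [state, sqNorm_mulVec, sqNorm, Finset.sum_eq_single alg.start]
    · simp
    · intro b _ hb
      simp [Pi.single_eq_of_ne hb]
    · simp
  | succ t ih => rw [state, sqNorm_mulVec, sqNorm_queryOp, ih]

theorem sum_queryMass_state_le (alg : QueryAlgorithm I A) (x : I → A) (t : ℕ) :
    ∑ i, queryMass (alg.state x t) i ≤ 1 := by
  rw [← alg.sqNorm_state x t, sqNorm_eq_sum_queryMass]
  exact le_add_of_nonneg_left (Finset.sum_nonneg fun _ _ => sq_nonneg _)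

theorem sqNorm_state_succ_sub (alg : QueryAlgorithm I A) (x y : I → A) (t : ℕ) :
    sqNorm (alg.state x (t + 1) - alg.state y (t + 1)) =
      sqNorm (queryOp x (alg.state x t) - queryOp y (alg.state y t)) := by
  rw [state, state, ← Matrix.mulVec_sub, sqNorm_mulVec]

/-- States with different acceptance probabilities are far apart. -/
theorem sq_le_sqNorm_state_sub (alg : QueryAlgorithm I A) (x y : I → A) (T : ℕ) {g : ℝ}
    (hg : 0 < g) (h : g ≤ alg.acceptProb T x - alg.acceptProb T y) :
    g ^ 2 ≤ 4 * sqNorm (alg.state x T - alg.state y T) := by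
  set a := alg.state x T with ha
  set b := alg.state y T with hb
  have hx : sqNorm a = 1 := alg.sqNorm_state x T
  have hy : sqNorm b = 1 := alg.sqNorm_state y T
  have key : alg.acceptProb T x - alg.acceptProb T y ≤
      ∑ i, ((2 / g) * ‖(a - b) i‖ ^ 2 + (g / 4) * (‖a i‖ ^ 2 + ‖b i‖ ^ 2)) := by
    unfold acceptProb
    rw [← Finset.sum_sub_distrib]
    have hterm : ∀ i, ‖a i‖ ^ 2 - ‖b i‖ ^ 2 ≤
        (2 / g) * ‖(a - b) i‖ ^ 2 + (g / 4) * (‖a i‖ ^ 2 + ‖b i‖ ^ 2) := by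
      intro i
      have h1 := norm_sub_norm_le (a i) (b i)
      have h2 := two_mul_le_of_one_le_mul (a := ‖a i - b i‖) (b := ‖a i‖ + ‖b i‖) (u := 4 / g) (v := g / 4)
        (by positivity) (by positivity) (by field_simp; norm_num)
      have h3 : ‖a i‖ ^ 2 - ‖b i‖ ^ 2 ≤ ‖a i - b i‖ * (‖a i‖ + ‖b i‖) := by
        nlinarith [norm_nonneg (a i), norm_nonneg (b i)]
      have h4 : (g / 4) * (‖a i‖ + ‖b i‖) ^ 2 ≤ (g / 4) * (2 * (‖a i‖ ^ 2 + ‖b i‖ ^ 2)) := by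
        refine mul_le_mul_of_nonneg_left ?_ (by positivity)
        nlinarith [sq_nonneg (‖a i‖ - ‖b i‖)]
      have h5 : (4 / g) * ‖a i - b i‖ ^ 2 = 2 * ((2 / g) * ‖a i - b i‖ ^ 2) := by ring
      rw [Pi.sub_apply]
      linarith
    refine (Finset.sum_le_sum fun i _ => hterm i).trans ?_
    exact Finset.sum_le_sum_of_subset_of_nonneg (Finset.subset_univ _) fun i _ _ => by positivity
  rw [Finset.sum_add_distrib, ← Finset.mul_sum, ← Finset.mul_sum, Finset.sum_add_distrib] at key
  change _ ≤ 2 / g * sqNorm (a - b) + g / 4 * (sqNorm a + sqNorm b) at key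
  rw [hx, hy] at key
  have h6 : g / 2 ≤ 2 / g * sqNorm (a - b) := by linarith
  have h7 := mul_le_mul_of_nonneg_left h6 hg.le
  have h8 : g * (2 / g * sqNorm (a - b)) = 2 * sqNorm (a - b) := by field_simp
  nlinarith

open Classical in
/-- The weighted adversary bound, for a symmetric relation `r` on an indexed family of inputs. -/
theorem adversary_bound (alg : QueryAlgorithm I A) {T : ℕ} {δ : ℝ} {promise P : (I → A) → Prop}
    (hδ : δ < 1 / 2) (hdec : alg.Decides T δ promise P) {C : Type} [Fintype C] (inp : C → I → A)
    (hinp : ∀ x, promise (inp x)) (r : C → C → Prop) (hsymm : ∀ x y, r x y → r y x)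
    (hP : ∀ x y, r x y → (P (inp x) ↔ ¬ P (inp y))) (w : C → I → ℝ) (hw : ∀ x i, 0 ≤ w x i)
    (hww : ∀ x y i, r x y → inp x i ≠ inp y i → 1 ≤ w x i * w y i) (B K : ℝ) (hB0 : 0 ≤ B)
    (hB : ∀ x i, (Finset.card {y | r x y ∧ inp x i ≠ inp y i} : ℝ) * w x i ≤ B)
    (hK : ∀ x, K ≤ (Finset.card {y | r x y} : ℝ)) [Nonempty C] :
    (1 - 2 * δ) ^ 2 * K ≤ 16 * B * T := by
  set Φ : ℕ → ℝ := fun t =>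
    ∑ x, ∑ y, if r x y then sqNorm (alg.state (inp x) t - alg.state (inp y) t) else 0 with hΦ
  have hstep : ∀ t, Φ (t + 1) ≤ Φ t + 4 * B * Fintype.card C := by
    intro t
    set S : C → C → ℝ := fun x y => if r x y then
      ∑ i, (if inp x i ≠ inp y i then 2 * (w x i * queryMass (alg.state (inp x) t) i) else 0)
      else 0 with hS
    have h1 : Φ (t + 1) ≤ Φ t + ((∑ x, ∑ y, S x y) + ∑ x, ∑ y, S y x) := by
      simp only [hΦ, ← Finset.sum_add_distrib]
      refine Finset.sum_le_sum fun x _ => Finset.sum_le_sum fun y _ => ?_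
      by_cases h : r x y
      · simp only [hS, if_pos h, if_pos (hsymm x y h), sqNorm_state_succ_sub]
        exact sqNorm_queryOp_sub_le _ _ _ _ _ _ (hw x) (hw y) fun i hi => hww x y i h hi
      · have h' : ¬ r y x := fun h' => h (hsymm y x h')
        simp [hS, h, h']
    have h2 : ∑ x, ∑ y, S y x = ∑ x, ∑ y, S x y := Finset.sum_comm
    have h3 : ∑ x, ∑ y, S x y ≤ 2 * B * Fintype.card C := by
      have h4 : ∀ x, ∑ y, S x y ≤ 2 * B := by
        intro x
        have h5 : ∑ y, S x y = ∑ i, ∑ y, if r x y ∧ inp x i ≠ inp y i then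
            2 * (w x i * queryMass (alg.state (inp x) t) i) else 0 := by
          rw [Finset.sum_comm]
          refine Finset.sum_congr rfl fun y _ => ?_
          by_cases h : r x y <;> simp [hS, h]
        rw [h5]
        calc _ ≤ ∑ i, 2 * B * queryMass (alg.state (inp x) t) i := by
              refine Finset.sum_le_sum fun i _ => ?_
              rw [← Finset.sum_filter, Finset.sum_const, nsmul_eq_mul]
              have h6 := mul_le_mul_of_nonneg_right (hB x i)
                (queryMass_nonneg (alg.state (inp x) t) i)
              linarith
          _ ≤ 2 * B := by
              rw [← Finset.mul_sum]
              exact mul_le_of_le_one_right (by linarith) (alg.sum_queryMass_state_le _ _)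
      calc _ ≤ ∑ _x : C, 2 * B := Finset.sum_le_sum fun x _ => h4 x
        _ = _ := by rw [Finset.sum_const, nsmul_eq_mul, Finset.card_univ]; ring
    linarith
  have hΦT : ∀ t : ℕ, Φ t ≤ t * (4 * B * Fintype.card C) := by
    intro t
    induction t with
    | zero => simp [hΦ, state, sqNorm]
    | succ t ih =>
      have := hstep t
      push_cast
      linarith
  have hend : (1 - 2 * δ) ^ 2 * K * Fintype.card C ≤ 4 * Φ T := by
    have h1 : ∀ x y, r x y →
        (1 - 2 * δ) ^ 2 ≤ 4 * sqNorm (alg.state (inp x) T - alg.state (inp y) T) := by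
      intro x y h
      have hx := hdec (inp x) (hinp x)
      have hy := hdec (inp y) (hinp y)
      by_cases hPx : P (inp x)
      · have := hx.1 hPx
        have := hy.2 ((hP x y h).1 hPx)
        exact alg.sq_le_sqNorm_state_sub _ _ _ (by linarith) (by linarith)
      · have hPy : P (inp y) := by
          by_contra h'
          exact hPx ((hP x y h).2 h')
        have := hx.2 hPx
        have := hy.1 hPy
        have h3 := alg.sq_le_sqNorm_state_sub (inp y) (inp x) T (g := 1 - 2 * δ)
          (by linarith) (by linarith)
        have h4 : sqNorm (alg.state (inp y) T - alg.state (inp x) T) =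
            sqNorm (alg.state (inp x) T - alg.state (inp y) T) := by
          simp [sqNorm, norm_sub_rev]
        rwa [h4] at h3
    have h2 : ∀ x, (1 - 2 * δ) ^ 2 * K ≤
        ∑ y, if r x y then 4 * sqNorm (alg.state (inp x) T - alg.state (inp y) T) else 0 := by
      intro x
      rw [← Finset.sum_filter]
      refine le_trans ?_ (Finset.card_nsmul_le_sum _ _ ((1 - 2 * δ) ^ 2) fun y hy =>
        h1 x y (by simpa using hy))
      rw [nsmul_eq_mul, mul_comm]
      exact mul_le_mul_of_nonneg_right (hK x) (sq_nonneg _)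
    have h3 := Finset.sum_le_sum fun x (_ : x ∈ (Finset.univ : Finset C)) => h2 x
    rw [Finset.sum_const, nsmul_eq_mul, Finset.card_univ] at h3
    rw [mul_comm]
    refine h3.trans (le_of_eq ?_)
    simp only [hΦ, Finset.mul_sum, mul_ite, mul_zero]
  have hC : (0 : ℝ) < Fintype.card C := by exact_mod_cast Fintype.card_pos
  have := hΦT T
  refine le_of_mul_le_mul_right ?_ hC
  linarith

end QueryAlgorithm

/-! ### Two crossing lanes -/

/-- A core of `s` vertices, and `L` layers of two vertices each. -/
abbrev LaneVertex (s L : ℕ) : Type := Fin s ⊕ Fin L × Bool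

/-- In each layer, whether the two lanes cross behind it, and at which position of the arrays of
this layer the edges to the next layer are. -/
abbrev LaneConfig (L D : ℕ) : Type := Fin L → Bool × Fin D

namespace LaneConfig

variable {s L D : ℕ}

/-- Whether the lanes have crossed an odd number of times before layer `k`. -/
def parity (x : LaneConfig L D) : ℕ → Bool
  | 0 => false
  | k + 1 => parity x k ^^ if h : k < L then (x ⟨k, h⟩).1 else false

/-- `x` and `y` differ in one layer, where the crossing is switched and the position is changed,
unless there is only one position. -/
def Neighbor (x y : LaneConfig L D) : Prop :=
  ∃ l, (∀ k, k ≠ l → x k = y k) ∧ (x l).1 ≠ (y l).1 ∧ ((x l).2 ≠ (y l).2 ∨ D = 1)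

theorem Neighbor.symm {x y : LaneConfig L D} (h : x.Neighbor y) : y.Neighbor x := by
  obtain ⟨l, h1, h2, h3⟩ := h
  exact ⟨l, fun k hk => (h1 k hk).symm, h2.symm, h3.imp_left Ne.symm⟩

theorem Neighbor.parity {x y : LaneConfig L D} (h : x.Neighbor y) : x.parity L = !y.parity L := by
  obtain ⟨l, h1, h2, -⟩ := h
  have key : ∀ k, x.parity k = (y.parity k ^^ decide ((l : ℕ) < k)) := by
    intro k
    induction k with
    | zero => simp [LaneConfig.parity]
    | succ k ih =>
      simp only [LaneConfig.parity, ih]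
      by_cases hk : k < L
      · by_cases hkl : (⟨k, hk⟩ : Fin L) = l
        · subst hkl
          have h3 : (x ⟨k, hk⟩).1 = !(y ⟨k, hk⟩).1 := Bool.eq_not_of_ne h2
          simp [hk, h3]
        · have h3 : (l : ℕ) < k + 1 ↔ (l : ℕ) < k := by
            rw [Fin.ext_iff] at hkl
            simp only at hkl
            omega
          simp only [hk, dif_pos, h1 _ hkl, h3]
          cases y.parity k <;> cases decide ((l : ℕ) < k) <;> simp
      · have := l.2
        simp [hk, show (l : ℕ) < k by omega, show (l : ℕ) < k + 1 by omega]
  simpa using key L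

/-- The vertex of the next layer; behind the last layer, one lane leads to the start of the lane
`true`, and the other one back to the core. -/
def next (s : ℕ) [NeZero s] [NeZero L] (x : LaneConfig L D) (l : Fin L) (c : Bool) :
    LaneVertex s L :=
  if h : (l : ℕ) + 1 < L then Sum.inr (⟨l + 1, h⟩, c ^^ (x l).1)
  else if c ^^ (x l).1 then Sum.inl 0 else Sum.inr (0, true)

/-- The `j`-th out-neighbour of a vertex. -/
def array (s : ℕ) [NeZero s] [NeZero L] (x : LaneConfig L D) : LaneVertex s L → ℕ → LaneVertex s L
  | Sum.inl i, j =>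
    if (i : ℕ) + 1 = s ∧ j = 0 then Sum.inr (0, false) else Sum.inl (Fin.ofNat s (i + 1 + j))
  | Sum.inr (l, c), j => if j = (x l).2 then x.next s l c else Sum.inl (Fin.ofNat s (j + 1))

/-- Out-degrees: those of the core are prescribed, those of the lanes are `D`. -/
def outDegree (D : ℕ) (dc : Fin s → ℕ) : LaneVertex s L → ℕ :=
  Sum.elim dc fun _ => D

variable [NeZero s] [NeZero L]

theorem ofNat_injOn {a b t : ℕ} (ha : a < s) (hb : b < s)
    (h : Fin.ofNat s (t + a) = Fin.ofNat s (t + b)) : a = b := by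
  have h1 : (t + a) % s = (t + b) % s := by simpa [Fin.ext_iff] using h
  have h2 : a ≡ b [MOD s] := Nat.ModEq.add_left_cancel' t h1
  exact h2.eq_of_lt_of_lt ha hb

theorem next_ne_ofNat (x : LaneConfig L D) (l : Fin L) (c : Bool) {j : ℕ} (hj : j + 1 < s) :
    x.next s l c ≠ Sum.inl (Fin.ofNat s (j + 1)) := by
  unfold next
  split_ifs
  · simp
  · intro h
    have h1 : (0 : Fin s) = Fin.ofNat s (j + 1) := Sum.inl_injective h
    have h2 : 0 = (j + 1) % s := by simpa [Fin.ext_iff] using h1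
    rw [Nat.mod_eq_of_lt hj] at h2
    omega
  · simp

theorem array_injOn (x : LaneConfig L D) {dc : Fin s → ℕ} (hD : D < s) (hdc : ∀ i, dc i < s)
    (u : LaneVertex s L) {j k : ℕ} (hj : j < outDegree D dc u) (hk : k < outDegree D dc u)
    (h : x.array s u j = x.array s u k) : j = k := by
  rcases u with i | ⟨l, c⟩
  · have hj' : j < s := lt_trans hj (hdc i)
    have hk' : k < s := lt_trans hk (hdc i)
    simp only [array] at h
    split_ifs at h with h1 h2 h2
    · omega
    · exact ofNat_injOn hj' hk' (Sum.inl_injective h)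
  · have hj' : j < D := hj
    have hk' : k < D := hk
    simp only [array] at h
    split_ifs at h with h1 h2 h2
    · omega
    · exact absurd h (x.next_ne_ofNat l c (by omega))
    · exact absurd h.symm (x.next_ne_ofNat l c (by omega))
    · have h3 := Sum.inl_injective h
      rw [add_comm j, add_comm k] at h3
      exact ofNat_injOn (by omega) (by omega) h3

theorem array_ne (x : LaneConfig L D) {dc : Fin s → ℕ} (hL : 2 ≤ L) (hdc : ∀ i, dc i < s)
    (u : LaneVertex s L) {j : ℕ} (hj : j < outDegree D dc u) : x.array s u j ≠ u := by
  rcases u with i | ⟨l, c⟩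
  · have hj' : j + 1 < s := lt_of_le_of_lt hj (hdc i)
    simp only [array]
    split_ifs with h1
    · simp
    · intro h
      have h2 : Fin.ofNat s (i + (1 + j)) = Fin.ofNat s (i + 0) := by
        simpa [add_assoc] using Sum.inl_injective h
      have := ofNat_injOn (by omega) (by omega) h2
      omega
  · simp only [array, next]
    split_ifs with h1 h2 h3
    · simp [Fin.ext_iff]
    · simp
    · intro h
      have h4 : (0 : Fin L) = l := congrArg Prod.fst (Sum.inr_injective h)
      have h5 : (l : ℕ) = 0 := by rw [← h4]; rfl
      omega
    · simp

/-- The edges of the graph. -/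
def Edge (dc : Fin s → ℕ) (x : LaneConfig L D) (u v : LaneVertex s L) : Prop :=
  ∃ j < outDegree D dc u, x.array s u j = v

theorem edge_next (dc : Fin s → ℕ) (x : LaneConfig L D) (l : Fin L) (c : Bool) :
    x.Edge dc (Sum.inr (l, c)) (x.next s l c) :=
  ⟨(x l).2, (x l).2.2, by simp [array]⟩

theorem reach_core (dc : Fin s → ℕ) (hdc : ∀ i, 0 < dc i) (x : LaneConfig L D) (i : Fin s) :
    Relation.ReflTransGen (x.Edge dc) (Sum.inl 0) (Sum.inl i) := by
  obtain ⟨i, hi⟩ := i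
  induction i with
  | zero => exact Relation.ReflTransGen.refl
  | succ i ih =>
    refine (ih (by omega)).tail ⟨0, hdc _, ?_⟩
    have : ¬ (i + 1 = s) := by omega
    simp [array, this, Fin.ext_iff, Nat.mod_eq_of_lt hi]

theorem reach_core_start (dc : Fin s → ℕ) (hdc : ∀ i, 0 < dc i) (x : LaneConfig L D) (i : Fin s) :
    Relation.ReflTransGen (x.Edge dc) (Sum.inl i) (Sum.inr (0, false)) := by
  obtain ⟨k, hk⟩ : ∃ k, (i : ℕ) + 1 + k = s := ⟨s - (i + 1), by omega⟩
  induction k generalizing i with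
  | zero =>
    exact Relation.ReflTransGen.single
      ⟨0, hdc _, by simp [array, show (i : ℕ) + 1 = s from hk]⟩
  | succ k ih =>
    have hi : (i : ℕ) + 1 < s := by omega
    refine Relation.ReflTransGen.head ?_ (ih ⟨i + 1, hi⟩ (by simp; omega))
    refine ⟨0, hdc _, ?_⟩
    have : ¬ ((i : ℕ) + 1 = s) := by omega
    simp [array, this, Fin.ext_iff, Nat.mod_eq_of_lt hi]

theorem reach_layer (dc : Fin s → ℕ) (x : LaneConfig L D) (c : Bool) (l : Fin L) :
    Relation.ReflTransGen (x.Edge dc) (Sum.inr (0, c)) (Sum.inr (l, c ^^ x.parity l)) := by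
  obtain ⟨l, hl⟩ := l
  induction l with
  | zero => simpa [parity] using Relation.ReflTransGen.refl
  | succ l ih =>
    refine (ih (by omega)).tail ?_
    have h := x.edge_next dc ⟨l, by omega⟩ (c ^^ x.parity l)
    have hl' : l < L := by omega
    simpa [next, parity, hl, hl', Bool.xor_assoc] using h

theorem reach_of_layer (dc : Fin s → ℕ) (x : LaneConfig L D) (c : Bool) (l : Fin L) :
    Relation.ReflTransGen (x.Edge dc) (Sum.inr (l, c ^^ x.parity l))
      (if c ^^ x.parity L then Sum.inl 0 else Sum.inr (0, true)) := by
  obtain ⟨k, hk⟩ : ∃ k, (l : ℕ) + 1 + k = L := ⟨L - (l + 1), by omega⟩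
  have hpar : ((c ^^ x.parity l) ^^ (x l).1) = (c ^^ x.parity (l + 1)) := by
    simp [parity]
  induction k generalizing l with
  | zero =>
    have h := x.edge_next dc l (c ^^ x.parity l)
    have hl : (l : ℕ) + 1 = L := hk
    rw [next, dif_neg (by omega), hpar, hl] at h
    exact Relation.ReflTransGen.single h
  | succ k ih =>
    have h := x.edge_next dc l (c ^^ x.parity l)
    have hl : (l : ℕ) + 1 < L := by omega
    rw [next, dif_pos hl, hpar] at h
    refine Relation.ReflTransGen.head h (ih ⟨l + 1, hl⟩ (by simp; omega) ?_)
    simp [parity, hl]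

theorem reach_zero_of_parity (dc : Fin s → ℕ) (x : LaneConfig L D)
    (hx : x.parity L = false) (c : Bool) (l : Fin L) :
    Relation.ReflTransGen (x.Edge dc) (Sum.inr (l, c)) (Sum.inl 0) := by
  have h1 : ∀ l, Relation.ReflTransGen (x.Edge dc) (Sum.inr (l, true ^^ x.parity l))
      (Sum.inl 0) := fun l => by simpa [hx] using x.reach_of_layer dc true l
  have h2 : Relation.ReflTransGen (x.Edge dc) (Sum.inr (l, false ^^ x.parity l))
      (Sum.inr (0, true)) := by simpa [hx] using x.reach_of_layer dc false l
  have h3 := h1 0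
  simp only [Fin.val_zero, parity] at h3
  have h4 := h2.trans h3
  have h5 := h1 l
  cases c <;> cases hp : x.parity l <;> simp_all

theorem reach_of_parity (dc : Fin s → ℕ) (hdc : ∀ i, 0 < dc i) (x : LaneConfig L D)
    (hx : x.parity L = false) (u v : LaneVertex s L) :
    Relation.ReflTransGen (x.Edge dc) u v := by
  have hu : Relation.ReflTransGen (x.Edge dc) u (Sum.inl 0) := by
    rcases u with i | ⟨l, c⟩
    · exact (x.reach_core_start dc hdc i).trans (x.reach_zero_of_parity dc hx _ _)
    · exact x.reach_zero_of_parity dc hx _ _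
  refine hu.trans ?_
  rcases v with i | ⟨l, c⟩
  · exact x.reach_core dc hdc i
  · have h0 := x.reach_core_start dc hdc 0
    have h1 := h0.trans (x.reach_layer dc false l)
    have h2 : Relation.ReflTransGen (x.Edge dc) (Sum.inr (0, false)) (Sum.inr (0, true)) := by
      have := x.reach_of_layer dc false 0
      simpa [hx, parity] using this
    have h3 := (h0.trans h2).trans (x.reach_layer dc true l)
    cases c <;> cases hp : x.parity l <;> simp_all

theorem not_reach_of_parity (dc : Fin s → ℕ) (x : LaneConfig L D) (hx : x.parity L = true) :
    ¬ Relation.ReflTransGen (x.Edge dc) (Sum.inl 0) (Sum.inr (0, true)) := by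
  intro h
  have key : ∀ v, Relation.ReflTransGen (x.Edge dc) (Sum.inl 0) v →
      ∀ l c, v = Sum.inr (l, c) → c = x.parity l := by
    intro v hv
    induction hv with
    | refl => simp
    | @tail u v _ huv ih =>
      obtain ⟨j, -, rfl⟩ := huv
      intro l c h
      rcases u with i | ⟨k, b⟩
      · simp only [array] at h
        split_ifs at h
        have h1 : ((0 : Fin L), false) = (l, c) := Sum.inr_injective h
        rw [Prod.mk.injEq] at h1
        simp [← h1.1, ← h1.2, parity]
      · have hb := ih k b rfl
        have hpar : (b ^^ (x k).1) = x.parity (k + 1) := by simp [hb, parity]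
        simp only [array, next, hpar] at h
        split_ifs at h with h1 h2 h3
        · have h4 := Sum.inr_injective h
          rw [Prod.mk.injEq] at h4
          rw [← h4.1, ← h4.2]
        · have h4 : (k : ℕ) + 1 = L := by omega
          rw [h4] at h3
          exact absurd hx h3
  have := key _ h 0 true rfl
  simp [parity] at this

/-! ### The inputs of the strong connectivity problem -/

/-- The adjacency arrays, for a numbering `e` of the vertices. -/
def input {n : ℕ} (e : LaneVertex s L ≃ Fin n) (dc : Fin s → ℕ) (x : LaneConfig L D) :
    ArrayPos (fun v => outDegree D dc (e.symm v)) → Fin n :=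
  fun p => e (x.array s (e.symm p.1) p.2)

theorem arraySimple_input {n : ℕ} (e : LaneVertex s L ≃ Fin n) (dc : Fin s → ℕ)
    (x : LaneConfig L D) (hL : 2 ≤ L) (hD : D < s) (hdc : ∀ i, dc i < s) :
    ArraySimple (x.input e dc) := by
  refine ⟨fun i j k h => Fin.ext ?_, fun p h => ?_⟩
  · exact x.array_injOn hD hdc _ j.2 k.2 (e.injective h)
  · exact x.array_ne hL hdc (e.symm p.1) p.2.2 (by rw [Equiv.eq_symm_apply]; exact h)

theorem adj_input_iff {n : ℕ} (e : LaneVertex s L ≃ Fin n) (dc : Fin s → ℕ)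
    (x : LaneConfig L D) (u v : Fin n) :
    (arrayDigraph (x.input e dc)).Adj u v ↔ x.Edge dc (e.symm u) (e.symm v) := by
  constructor
  · rintro ⟨j, rfl⟩
    exact ⟨j, j.2, by simp [input]⟩
  · rintro ⟨j, hj, h⟩
    exact ⟨⟨j, hj⟩, by simp [input, h]⟩

theorem stronglyConn_input_iff {n : ℕ} (e : LaneVertex s L ≃ Fin n) (dc : Fin s → ℕ)
    (hdc : ∀ i, 0 < dc i) (x : LaneConfig L D) :
    (arrayDigraph (x.input e dc)).StronglyConn ↔ x.parity L = false := by
  constructor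
  · intro h
    by_contra hx
    refine x.not_reach_of_parity dc (by simpa using hx) ?_
    have h1 := (h (e (Sum.inl 0)) (e (Sum.inr (0, true)))).lift (p := x.Edge dc) e.symm
      fun u v huv => (x.adj_input_iff e dc u v).1 huv
    simpa [Function.onFun] using h1
  · intro hx u v
    have h1 := (x.reach_of_parity dc hdc hx (e.symm u) (e.symm v)).lift
      (p := (arrayDigraph (x.input e dc)).Adj) e
      fun u v huv => (x.adj_input_iff e dc _ _).2 (by simpa using huv)
    simpa [Function.onFun] using h1

end LaneConfig

/-! ### The adversary weights -/

namespace LaneConfig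

variable {s L D : ℕ}

/-- The number of positions to which the edges of a layer can be moved. -/
def moves (D : ℕ) : ℕ := max 1 (D - 1)

theorem card_moves (p : Fin D) : Finset.card {q | p ≠ q ∨ D = 1} = moves D := by
  classical
  unfold moves
  by_cases hD : D = 1
  · subst hD
    simp
  · have h : (Finset.univ.filter fun q : Fin D => p ≠ q ∨ D = 1) = Finset.univ.erase p := by
      ext q
      simp [hD, eq_comm]
    have := p.2
    rw [h, Finset.card_erase_of_mem (Finset.mem_univ p), Finset.card_univ, Fintype.card_fin]
    omega

open Classical in
theorem le_card_neighbor (x : LaneConfig L D) :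
    L * moves D ≤ Finset.card {y | x.Neighbor y} := by
  let S : Finset (Σ _ : Fin L, Fin D) :=
    Finset.univ.sigma fun l => {q | (x l).2 ≠ q ∨ D = 1}
  have hS : S.card = L * moves D := by
    simp only [S, Finset.card_sigma, card_moves]
    simp
  rw [← hS]
  refine Finset.card_le_card_of_injOn
    (fun a => Function.update x a.1 (!(x a.1).1, a.2)) ?_ ?_
  · rintro ⟨l, q⟩ h
    have h' : (x l).2 ≠ q ∨ D = 1 := by simpa [S] using h
    have hN : x.Neighbor (Function.update x l (!(x l).1, q)) :=
      ⟨l, fun k hk => by simp [Function.update_of_ne hk], by simp, by simpa using h'⟩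
    simpa using hN
  · rintro ⟨l, q⟩ - ⟨l', q'⟩ - h
    simp only at h
    have hl : l = l' := by
      by_contra hl
      have h1 := congrArg Prod.fst (congrFun h l)
      simp [Function.update_of_ne hl] at h1
    subst hl
    have h2 := congrArg Prod.snd (congrFun h l)
    simp only [Function.update_self] at h2
    rw [h2]

/-- The weights of the adversary bound. -/
noncomputable def weight (x : LaneConfig L D) : LaneVertex s L → ℕ → ℝ
  | Sum.inl _, _ => 1
  | Sum.inr (l, _), j => if j = (x l).2 then (√(moves D))⁻¹ else √(moves D)

theorem one_le_moves : 1 ≤ moves D := le_max_left _ _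

theorem sqrt_moves_pos : 0 < √(moves D : ℝ) := by
  have := one_le_moves (D := D)
  positivity

theorem weight_nonneg (x : LaneConfig L D) (u : LaneVertex s L) (j : ℕ) : 0 ≤ x.weight u j := by
  have := sqrt_moves_pos (D := D)
  rcases u with i | ⟨l, c⟩ 
  · exact zero_le_one
  · simp only [weight]
    split_ifs <;> positivity

variable [NeZero s] [NeZero L]

/-- Where the inputs of neighbours differ. -/
theorem array_ne_of_neighbor {x y : LaneConfig L D} (h : x.Neighbor y) {u : LaneVertex s L} {j : ℕ}
    (hj : x.array s u j ≠ y.array s u j) :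
    ∃ l c, u = Sum.inr (l, c) ∧ (∀ k, k ≠ l → x k = y k) ∧ (x l).1 ≠ (y l).1 ∧
      ((x l).2 ≠ (y l).2 ∨ D = 1) ∧ (j = (x l).2 ∨ j = (y l).2) := by
  obtain ⟨l, h1, h2, h3⟩ := h
  rcases u with i | ⟨k, c⟩
  · exact absurd rfl hj
  · have hk : k = l := by
      by_contra hk
      exact hj (by simp [array, next, h1 k hk])
    subst hk
    refine ⟨k, c, rfl, h1, h2, h3, ?_⟩
    by_contra! h4
    exact hj (by simp [array, h4.1, h4.2])

theorem one_le_weight_mul_weight {x y : LaneConfig L D} (h : x.Neighbor y) {u : LaneVertex s L}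
    {j : ℕ} (hj : x.array s u j ≠ y.array s u j) : 1 ≤ x.weight u j * y.weight u j := by
  obtain ⟨l, c, rfl, -, -, h3, h4⟩ := array_ne_of_neighbor h hj
  have hpos := sqrt_moves_pos (D := D)
  have hN : D = 1 → √(moves D : ℝ) = 1 := by
    rintro rfl
    simp [moves]
  simp only [weight]
  split_ifs with h5 h6 h6
  · have : D = 1 := h3.resolve_left fun h => h (Fin.ext (h5.symm.trans h6))
    simp [hN this]
  · rw [inv_mul_cancel₀ hpos.ne']
  · rw [mul_inv_cancel₀ hpos.ne']
  · omega

open Classical in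
theorem card_mul_weight_le (x : LaneConfig L D) (u : LaneVertex s L) (j : ℕ) :
    (Finset.card {y | x.Neighbor y ∧ x.array s u j ≠ y.array s u j} : ℝ) * x.weight u j ≤
      √(moves D) := by
  have hpos := sqrt_moves_pos (D := D)
  set S : Finset (LaneConfig L D) := {y | x.Neighbor y ∧ x.array s u j ≠ y.array s u j} with hS
  rcases u with i | ⟨l, c⟩
  · have : S = ∅ := by
      ext y
      simp [hS, array]
    simp [this]
  · have hmem : ∀ y ∈ S, (∀ k, k ≠ l → x k = y k) ∧ (x l).1 ≠ (y l).1 ∧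
        ((x l).2 ≠ (y l).2 ∨ D = 1) ∧ (j = (x l).2 ∨ j = (y l).2) := by
      intro y hy
      have hy' : x.Neighbor y ∧ x.array s (Sum.inr (l, c)) j ≠ y.array s (Sum.inr (l, c)) j := by
        simpa [hS] using hy
      obtain ⟨l', c', h0, h⟩ := array_ne_of_neighbor hy'.1 hy'.2
      have hl : l = l' := congrArg Prod.fst (Sum.inr_injective h0)
      subst hl
      exact h
    have hinj : Set.InjOn (fun y : LaneConfig L D => (y l).2) S := by
      intro y hy z hz h
      have h1 := hmem y hy
      have h2 := hmem z hz
      funext k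
      by_cases hk : k = l
      · subst hk
        refine Prod.ext ?_ h
        have h3 := Bool.eq_not_of_ne h1.2.1
        have h4 := Bool.eq_not_of_ne h2.2.1
        rw [h3] at h4
        simpa using h4
      · rw [← h1.1 k hk, h2.1 k hk]
    simp only [weight]
    split_ifs with hj
    · have hcard : S.card ≤ moves D := by
        rw [← card_moves (x l).2]
        exact Finset.card_le_card_of_injOn _ (fun y hy => by simpa using (hmem y hy).2.2.1) hinj
      calc (S.card : ℝ) * (√(moves D : ℝ))⁻¹ ≤ moves D * (√(moves D : ℝ))⁻¹ := by
            gcongr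
        _ = √(moves D) := by
            rw [← div_eq_mul_inv, Real.div_sqrt]
    · have hcard : S.card ≤ 1 := by
        refine Finset.card_le_one.2 fun y hy z hz => hinj hy hz (Fin.ext ?_)
        have h1 := (hmem y hy).2.2.2.resolve_left hj
        have h2 := (hmem z hz).2.2.2.resolve_left hj
        exact h1.symm.trans h2
      have : (S.card : ℝ) ≤ 1 := by exact_mod_cast hcard
      exact mul_le_of_le_one_left hpos.le this

end LaneConfig

open LaneConfig in
/-- The query lower bound for the out-degrees of the lane graphs. -/
theorem query_bound_of_lanes {s L D n T : ℕ} {δ : ℝ} [NeZero s] [NeZero n] (hδ : δ < 1 / 2)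
    (hL : 2 ≤ L) (hD0 : 0 < D) (hD : D < s) (dc : Fin s → ℕ) (hdc : ∀ i, 0 < dc i ∧ dc i < s)
    (e : LaneVertex s L ≃ Fin n)
    (alg : QueryAlgorithm (ArrayPos fun v => outDegree D dc (e.symm v)) (Fin n))
    (h : alg.Decides T δ ArraySimple fun f => (arrayDigraph f).StronglyConn) :
    (1 - 2 * δ) ^ 2 * (L * √(moves D)) ≤ 16 * T := by
  have : NeZero L := ⟨by omega⟩
  have : NeZero D := ⟨by omega⟩
  have hpos := sqrt_moves_pos (D := D)
  have key := alg.adversary_bound hδ h (C := LaneConfig L D) (fun x => x.input e dc)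
    (fun x => x.arraySimple_input e dc hL hD fun i => (hdc i).2) Neighbor
    (fun _ _ h => h.symm)
    (fun x y h => by
      rw [stronglyConn_input_iff e dc fun i => (hdc i).1,
        stronglyConn_input_iff e dc fun i => (hdc i).1, h.parity]
      simp)
    (fun x p => x.weight (e.symm p.1) p.2) (fun x p => x.weight_nonneg _ _)
    (fun x y p h hp => one_le_weight_mul_weight h fun h' => hp (congrArg e h'))
    (√(moves D)) (L * moves D) hpos.le
    (fun x p => by
      have hne : ∀ y : LaneConfig L D, x.input e dc p ≠ y.input e dc p ↔
          x.array s (e.symm p.1) p.2 ≠ y.array s (e.symm p.1) p.2 := fun y => e.injective.ne_iff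
      refine le_of_eq_of_le (congrArg (fun k : ℕ => (k : ℝ) * x.weight (e.symm p.1) p.2)
        (congrArg Finset.card (Finset.ext fun y => ?_))) (x.card_mul_weight_le (e.symm p.1) p.2)
      simp only [Finset.mem_filter, hne])
    (fun x => by exact_mod_cast x.le_card_neighbor)
  refine le_of_mul_le_mul_right ?_ hpos
  have h2 : √(moves D : ℝ) * √(moves D : ℝ) = moves D := Real.mul_self_sqrt (Nat.cast_nonneg _)
  calc _ = (1 - 2 * δ) ^ 2 * (L * (√(moves D : ℝ) * √(moves D : ℝ))) := by ring
    _ ≤ _ := by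
      rw [h2]
      linarith

/-! ### The choice of the parameters -/

theorem exists_sum_eq_of_le_mul (s M r : ℕ) (h : r ≤ s * M) :
    ∃ a : Fin s → ℕ, (∀ i, a i ≤ M) ∧ ∑ i, a i = r := by
  induction s generalizing r with
  | zero => exact ⟨0, by simp, by simp at h; simp [h]⟩
  | succ s ih =>
    rw [add_mul] at h
    obtain ⟨a, h1, h2⟩ := ih (r - min M r) (by omega)
    refine ⟨Fin.cons (min M r) a, fun i => ?_, ?_⟩
    · refine Fin.cases ?_ (fun i => ?_) i
      · simp
      · simpa using h1 i
    · rw [Fin.sum_univ_succ]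
      simp only [Fin.cons_zero, Fin.cons_succ, h2]
      omega

/-- Out-degrees with sum `m` for a core of `s` vertices and `L` layers. -/
theorem exists_outDegree {s L m : ℕ} (hL : 0 < L) (hLs : 2 * L ≤ s * (s - 2)) (hs : 2 ≤ s)
    (hm : s + 2 * L ≤ m) (hm' : m ≤ (s - 1) * (s + 2 * L)) :
    ∃ D : ℕ, 0 < D ∧ D < s ∧ m ≤ 2 * (s + 2 * L) * D ∧
      ∃ dc : Fin s → ℕ, (∀ i, 0 < dc i ∧ dc i < s) ∧
        ∑ v : LaneVertex s L, LaneConfig.outDegree D dc v = m := by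
  obtain ⟨t, rfl⟩ := Nat.exists_eq_add_of_le hm
  obtain ⟨q, hqs, hqt, hr, hmq⟩ : ∃ q, q ≤ s - 2 ∧ 2 * L * q ≤ t ∧ t - 2 * L * q ≤ s * (s - 2) ∧
      s + 2 * L + t ≤ 2 * (s + 2 * L) * (q + 1) := by
    have h1 : 2 * L * (t / (2 * L)) ≤ t := Nat.mul_div_le t (2 * L)
    have h2 : t < 2 * L * (t / (2 * L) + 1) := by
      have := Nat.lt_mul_div_succ t (show 0 < 2 * L by omega)
      exact this
    rcases le_total (t / (2 * L)) (s - 2) with h | h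
    · refine ⟨t / (2 * L), h, h1, ?_, ?_⟩
      · rw [mul_add, mul_one] at h2
        omega
      · generalize t / (2 * L) = q at *
        nlinarith [Nat.zero_le (s * q), Nat.zero_le (L * q)]
    · refine ⟨s - 2, le_rfl, (Nat.mul_le_mul_left _ h).trans h1, ?_, ?_⟩
      · obtain ⟨k, rfl⟩ := Nat.exists_eq_add_of_le hs
        simp only [Nat.add_sub_cancel_left, show 2 + k - 1 = k + 1 by omega] at *
        rw [Nat.sub_le_iff_le_add]
        nlinarith
      · rw [show s - 2 + 1 = s - 1 by omega, mul_assoc, mul_comm (s + 2 * L)]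
        omega
  obtain ⟨a, ha, hsum⟩ := exists_sum_eq_of_le_mul s (s - 2) _ hr
  refine ⟨q + 1, by omega, by omega, hmq, fun i => a i + 1, fun i => ?_, ?_⟩
  · have := ha i
    exact ⟨Nat.succ_pos _, show a i + 1 < s by omega⟩
  · simp only [LaneConfig.outDegree, Fintype.sum_sum_type, Sum.elim_inl, Sum.elim_inr,
      Finset.sum_add_distrib (f := a), hsum, Finset.sum_const, Finset.card_univ, Fintype.card_prod,
      Fintype.card_fin, Fintype.card_bool, smul_eq_mul]
    rw [mul_comm L 2, mul_add (2 * L)]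
    omega


theorem mainTheorem7 :
    ∀ (ε δ : ℝ), 0 < ε → δ < 1 / 2 →
      ∃ c : ℝ, 0 < c ∧ ∃ N : ℕ, ∀ (n m : ℕ) [NeZero n],
        N ≤ n → n ≤ m → (m : ℝ) ≤ (1 - ε) * (n : ℝ) ^ 2 →
          ∀ T : ℕ, StrongConnectivitySolvable n m T δ →
            c * Real.sqrt ((n : ℝ) * (m : ℝ)) ≤ (T : ℝ) := by
  intro ε δ hε hδ
  set η : ℝ := min ε (1 / 2) with hη
  have hη0 : 0 < η := lt_min hε (by norm_num)
  have hηε : η ≤ ε := min_le_left _ _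
  have hη2 : η ≤ 1 / 2 := min_le_right _ _
  have hδ' : 0 < (1 - 2 * δ) ^ 2 := pow_pos (by linarith) 2
  refine ⟨(1 - 2 * δ) ^ 2 * η / 256, by positivity, ⌈16 / η⌉₊, ?_⟩
  intro n m _ hN hnm hm T hsolv
  have hn : 16 ≤ η * n := by
    have := Nat.ceil_le.1 hN
    rwa [div_le_iff₀ hη0, mul_comm] at this
  have hn32 : (32 : ℝ) ≤ n := by nlinarith
  set L := ⌊η * n / 4⌋₊ with hLdef
  have hL1 : (L : ℝ) ≤ η * n / 4 := Nat.floor_le (by positivity)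
  have hL2 : η * n / 8 ≤ L := by
    have := Nat.lt_floor_add_one (η * n / 4)
    linarith
  have hL : 2 ≤ L := by
    have : (2 : ℝ) ≤ L := by linarith
    exact_mod_cast this
  have hLn : 8 * L ≤ n := by
    have : (8 * L : ℝ) ≤ n := by nlinarith
    exact_mod_cast this
  have hn32' : 32 ≤ n := by exact_mod_cast hn32
  obtain ⟨s, hs⟩ : ∃ s, n = s + 2 * L := ⟨n - 2 * L, by omega⟩
  have hs2 : 8 ≤ s := by omega
  have hLs : 2 * L ≤ s * (s - 2) := by
    have : s * 1 ≤ s * (s - 2) := Nat.mul_le_mul_left _ (by omega)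
    omega
  have hms : m ≤ (s - 1) * (s + 2 * L) := by
    have h1 : (n : ℝ) = s + 2 * L := by exact_mod_cast hs
    have h2 : (m : ℝ) ≤ (s - 1) * n := by
      have h3 : (1 - ε) * (n : ℝ) ≤ s - 1 := by nlinarith
      nlinarith
    rw [h1] at h2
    have h3 : ((s - 1 : ℕ) : ℝ) = s - 1 := by
      rw [Nat.cast_sub (by omega), Nat.cast_one]
    rw [← h3] at h2
    exact_mod_cast h2
  obtain ⟨D, hD0, hDs, hmD, dc, hdc, hsum⟩ :=
    exists_outDegree (by omega) hLs (by omega) (hs ▸ hnm) hms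
  have : NeZero s := ⟨by omega⟩
  have e : LaneVertex s L ≃ Fin n := Fintype.equivFinOfCardEq (by simp; omega)
  obtain ⟨alg, halg⟩ := hsolv (fun v => LaneConfig.outDegree D dc (e.symm v))
    (by rw [Equiv.sum_comp e.symm (LaneConfig.outDegree D dc), hsum])
  have key := query_bound_of_lanes hδ hL hD0 hDs dc hdc e alg halg
  have hmoves : (m : ℝ) ≤ 4 * n * LaneConfig.moves D := by
    have h1 : D ≤ 2 * LaneConfig.moves D := by
      unfold LaneConfig.moves
      omega
    have h2 : m ≤ 4 * n * LaneConfig.moves D := by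
      rw [← hs] at hmD
      nlinarith
    exact_mod_cast h2
  have hsqrt : √((n : ℝ) * m) ≤ 2 * n * √(LaneConfig.moves D) := by
    refine Real.sqrt_le_iff.2 ⟨by positivity, ?_⟩
    rw [mul_pow, Real.sq_sqrt (Nat.cast_nonneg _)]
    nlinarith
  have hlow : η * n / 8 * √(LaneConfig.moves D) ≤ L * √(LaneConfig.moves D) :=
    mul_le_mul_of_nonneg_right hL2 (Real.sqrt_nonneg _)
  have h1 := mul_le_mul_of_nonneg_left hlow hδ'.le
  have h2 := mul_le_mul_of_nonneg_left hsqrt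
    (show 0 ≤ (1 - 2 * δ) ^ 2 * η / 256 by positivity)
  linarith
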